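/- Let $V$ and $V_*$ be complex vector spaces of countably infinite dimension with a non-degenerate bilinear pairing $V_*\otimes V\to\mathbb{C}$, and regard $V_*$ through this pairing as a subspace of the full dual $V^*$. Let $\mathfrak{g}^M$ be the associated Mackey Lie algebra, i.e. the Lie algebra (under the commutator) of all endomorphisms $\varphi$ of $V$ whose dual map $V^*\to V^*$, $f\mapsto f\circ\varphi$, maps $V_*$ into itself. It acts on $V^*$ by $\varphi\cdot f=-f\circ\varphi$, hence on the quotient $V^*/V_*$, and on tensor powers of $V^*/V_*$ by the Leibniz rule. For a partition $\lambda=(\lambda_1\ge\dots\ge\lambda_m\ge 0)$ with $k=|\lambda|$, let $(V^*/V_*)_\lambda=c_\lambda\,(V^*/V_*)^{\otimes k}$ be the image of $V^*/V_*$ under the Schur functor of $\lambda$, where $c_\lambda\in\mathbb{C}[S_k]$ is the Young symmetrizer of $\lambda$ acting by permutation of the tensor factors. Then for every partition $\lambda$ the $\mathfrak{g}^M$-module $(V^*/V_*)_\lambda$ is simple. -/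

import Mathlib

open scoped TensorProduct

noncomputable section

/-! ### The Mackey Lie algebra of a pairing -/

section Mackey

attribute [local instance] LieRing.ofAssociativeRing

variable {V W : Type*} [AddCommGroup V] [Module ℂ V] [AddCommGroup W] [Module ℂ W]

/-- The Mackey Lie algebra of a pairing `B : W × V → ℂ`: all endomorphisms of `V` (with the
commutator bracket) whose dual maps `V^*` to itself preserving the image of `W` in `V^*`. -/
def mackeyLieAlgebra (B : W →ₗ[ℂ] V →ₗ[ℂ] ℂ) : LieSubalgebra ℂ (Module.End ℂ V) where
  carrier := {φ | ∀ f ∈ LinearMap.range B, f ∘ₗ φ ∈ LinearMap.range B}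
  add_mem' {a b} ha hb f hf := by
    rw [LinearMap.comp_add]
    exact add_mem (ha f hf) (hb f hf)
  zero_mem' f hf := by
    rw [LinearMap.comp_zero]
    exact zero_mem _
  smul_mem' c a ha f hf := by
    rw [LinearMap.comp_smul]
    exact Submodule.smul_mem _ _ (ha f hf)
  lie_mem' {a b} ha hb f hf := by
    have h : f ∘ₗ ⁅a, b⁆ = (f ∘ₗ a) ∘ₗ b - (f ∘ₗ b) ∘ₗ a := by
      rw [LieRing.of_associative_ring_bracket, LinearMap.comp_sub]
      rfl
    rw [h]
    exact sub_mem (hb _ (ha f hf)) (ha _ (hb f hf))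

/-- The image of `W` in the full dual `V^*`, as a submodule over the Mackey Lie algebra. The action
on `V^*` is the contragredient one, `(φ • f) v = - f (φ v)`. -/
def pairingRange (B : W →ₗ[ℂ] V →ₗ[ℂ] ℂ) :
    LieSubmodule ℂ (mackeyLieAlgebra B) (V →ₗ[ℂ] ℂ) where
  __ := LinearMap.range B
  lie_mem {x f} hf := by
    have h : ⁅x, f⁆ = -(f ∘ₗ (x : Module.End ℂ V)) := rfl
    rw [h]
    exact neg_mem (x.2 f hf)

/-- The quotient `V^* / W`, a module over the Mackey Lie algebra. -/
abbrev DualQuotient (B : W →ₗ[ℂ] V →ₗ[ℂ] ℂ) : Type _ :=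
  (V →ₗ[ℂ] ℂ) ⧸ pairingRange B

end Mackey

/-! ### Tensor powers of a Lie module, and the action of the symmetric group -/

section TensorPower

variable {R L M ι : Type*} [CommRing R] [LieRing L] [LieAlgebra R L] [AddCommGroup M] [Module R M]
  [LieRingModule L M] [LieModule R L M]

section LieAction

variable [DecidableEq ι]

/-- An endomorphism of `M` acting on the `i`-th tensor factor of `⨂_{i} M`, linearly in the
endomorphism. -/
def tensorFactorAction (R M : Type*) [CommRing R] [AddCommGroup M] [Module R M] (i : ι) :
    Module.End R M →ₗ[R] Module.End R (⨂[R] _ : ι, M) :=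
  (PiTensorProduct.mapMultilinear R (fun _ : ι => M) (fun _ : ι => M)).toLinearMap
    (fun _ => LinearMap.id) i

theorem tensorFactorAction_tprod (i : ι) (a : Module.End R M) (m : ι → M) :
    tensorFactorAction R M i a (PiTensorProduct.tprod R m) =
      PiTensorProduct.tprod R (Function.update m i (a (m i))) := by
  have h : tensorFactorAction R M i a =
      PiTensorProduct.map (Function.update (fun _ => LinearMap.id) i a) := rfl
  rw [h, PiTensorProduct.map_tprod]
  congr 1
  funext j
  by_cases hj : j = i
  · subst hj; simp
  · simp [hj]

variable [Fintype ι]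

/-- The usual action of a Lie algebra on a tensor power of a module:
`x • (m₁ ⊗ ⋯ ⊗ m_k) = ∑ i, m₁ ⊗ ⋯ ⊗ (x • m_i) ⊗ ⋯ ⊗ m_k`. -/
def tensorPowerAction (R L M ι : Type*) [CommRing R] [LieRing L] [LieAlgebra R L] [AddCommGroup M]
    [Module R M] [LieRingModule L M] [LieModule R L M] [Fintype ι] [DecidableEq ι] :
    L →ₗ[R] Module.End R (⨂[R] _ : ι, M) :=
  (∑ i : ι, tensorFactorAction R M i) ∘ₗ (LieModule.toEnd R L M : L →ₗ[R] Module.End R M)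

theorem tensorPowerAction_tprod (x : L) (m : ι → M) :
    tensorPowerAction R L M ι x (PiTensorProduct.tprod R m) =
      ∑ i, PiTensorProduct.tprod R (Function.update m i ⁅x, m i⁆) := by
  simp [tensorPowerAction, LinearMap.sum_apply, tensorFactorAction_tprod]

theorem tensorPowerAction_lie (x y : L) :
    tensorPowerAction R L M ι ⁅x, y⁆ =
      tensorPowerAction R L M ι x * tensorPowerAction R L M ι y -
        tensorPowerAction R L M ι y * tensorPowerAction R L M ι x := by
  ext m
  simp only [LinearMap.compMultilinearMap_apply, LinearMap.sub_apply, Module.End.mul_apply,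
    tensorPowerAction_tprod, map_sum]
  rw [Finset.sum_comm, ← Finset.sum_sub_distrib]
  refine Finset.sum_congr rfl fun i _ => ?_
  rw [← Finset.sum_sub_distrib, Finset.sum_eq_single i]
  · simp [← MultilinearMap.map_update_sub]
  · intro j _ hj
    rw [Function.update_of_ne hj, Function.update_of_ne hj.symm, Function.update_comm hj, sub_self]
  · simp

instance PiTensorProduct.instLieRingModuleTensorPower : LieRingModule L (⨂[R] _ : ι, M) where
  bracket x t := tensorPowerAction R L M ι x t
  add_lie x y t := by simp
  lie_add x s t := by simp
  leibniz_lie x y t := by simp [tensorPowerAction_lie]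

instance PiTensorProduct.instLieModuleTensorPower : LieModule R L (⨂[R] _ : ι, M) where
  smul_lie c x t := by
    change tensorPowerAction R L M ι (c • x) t = c • tensorPowerAction R L M ι x t
    simp
  lie_smul c x t := by
    change tensorPowerAction R L M ι x (c • t) = c • tensorPowerAction R L M ι x t
    simp

theorem lie_tprod (x : L) (m : ι → M) :
    ⁅x, PiTensorProduct.tprod R m⁆ =
      ∑ i, PiTensorProduct.tprod R (Function.update m i ⁅x, m i⁆) :=
  tensorPowerAction_tprod x m

end LieAction

/-- The symmetric group of the index set acting on a tensor power by permuting the tensor factors: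
`σ • ⨂_{i} m_i = ⨂_{i} m_{σ⁻¹ i}`. -/
def permTensorRep (R M ι : Type*) [CommRing R] [AddCommGroup M] [Module R M] :
    Representation R (Equiv.Perm ι) (⨂[R] _ : ι, M) where
  toFun σ := (PiTensorProduct.reindex R (fun _ : ι => M) σ).toLinearMap
  map_one' := by
    ext m
    exact PiTensorProduct.reindex_tprod (1 : Equiv.Perm ι) m
  map_mul' σ τ := by
    ext m
    have h1 := PiTensorProduct.reindex_tprod (R := R) (σ * τ) m
    have h2 := PiTensorProduct.reindex_tprod (R := R) τ m
    have h3 := PiTensorProduct.reindex_tprod (R := R) σ (fun i => m (τ.symm i))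
    exact h1.trans (h3.symm.trans (congrArg (PiTensorProduct.reindex R (fun _ : ι => M) σ) h2.symm))

theorem permTensorRep_tprod (σ : Equiv.Perm ι) (m : ι → M) :
    permTensorRep R M ι σ (PiTensorProduct.tprod R m) =
      PiTensorProduct.tprod R (fun i => m (σ.symm i)) :=
  PiTensorProduct.reindex_tprod σ m

variable [Fintype ι] [DecidableEq ι]

theorem permTensorRep_lie (σ : Equiv.Perm ι) (x : L) (t : ⨂[R] _ : ι, M) :
    permTensorRep R M ι σ ⁅x, t⁆ = ⁅x, permTensorRep R M ι σ t⁆ := by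
  have h : permTensorRep R M ι σ ∘ₗ tensorPowerAction R L M ι x =
      tensorPowerAction R L M ι x ∘ₗ permTensorRep R M ι σ := by
    ext m
    simp only [LinearMap.compMultilinearMap_apply, LinearMap.comp_apply, permTensorRep_tprod,
      tensorPowerAction_tprod, map_sum]
    refine Fintype.sum_equiv σ _ _ fun i => ?_
    congr 1
    funext j
    by_cases hj : j = σ i
    · rw [hj, Equiv.symm_apply_apply, Function.update_self, Function.update_self]
    · have hj' : σ.symm j ≠ i := fun h => hj (by rw [← h, Equiv.apply_symm_apply])
      simp [hj, hj']
  exact LinearMap.congr_fun h t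

theorem permTensorRep_asAlgebraHom_lie (c : MonoidAlgebra R (Equiv.Perm ι)) (x : L)
    (t : ⨂[R] _ : ι, M) :
    (permTensorRep R M ι).asAlgebraHom c ⁅x, t⁆ = ⁅x, (permTensorRep R M ι).asAlgebraHom c t⁆ := by
  induction c using MonoidAlgebra.induction_on with
  | of σ => simp [permTensorRep_lie]
  | add a b ha hb => simp [ha, hb]
  | smul r a ha => simp [ha]

/-- An element of the group algebra of the symmetric group, acting on a tensor power of a Lie
module by a homomorphism of Lie modules. -/
def groupAlgebraTensorHom (R L M : Type*) [CommRing R] [LieRing L] [LieAlgebra R L]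
    [AddCommGroup M] [Module R M] [LieRingModule L M] [LieModule R L M]
    (c : MonoidAlgebra R (Equiv.Perm ι)) :
    (⨂[R] _ : ι, M) →ₗ⁅R,L⁆ (⨂[R] _ : ι, M) where
  __ := (permTensorRep R M ι).asAlgebraHom c
  map_lie' {x t} := permTensorRep_asAlgebraHom_lie c x t

end TensorPower

/-! ### Young symmetrizers and Schur functors

The tensor power of degree `k = |μ|` is indexed by the `k` cells of the Young diagram `μ`, so that
`S_k` is the group of permutations of the cells, and no numbering of the cells has to be chosen. -/

section Schur

/-- The permutations of the cells of `μ` that preserve each row. -/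
def YoungDiagram.rowStabilizer (μ : YoungDiagram) : Subgroup (Equiv.Perm μ.cells) where
  carrier := {σ | ∀ c, (σ c).1.1 = c.1.1}
  mul_mem' {σ τ} hσ hτ c := by rw [Equiv.Perm.mul_apply, hσ, hτ]
  one_mem' c := rfl
  inv_mem' {σ} hσ c := by
    have h := hσ (σ⁻¹ c)
    rwa [← Equiv.Perm.mul_apply, mul_inv_cancel, Equiv.Perm.one_apply, eq_comm] at h

/-- The permutations of the cells of `μ` that preserve each column. -/
def YoungDiagram.colStabilizer (μ : YoungDiagram) : Subgroup (Equiv.Perm μ.cells) where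
  carrier := {σ | ∀ c, (σ c).1.2 = c.1.2}
  mul_mem' {σ τ} hσ hτ c := by rw [Equiv.Perm.mul_apply, hσ, hτ]
  one_mem' c := rfl
  inv_mem' {σ} hσ c := by
    have h := hσ (σ⁻¹ c)
    rwa [← Equiv.Perm.mul_apply, mul_inv_cancel, Equiv.Perm.one_apply, eq_comm] at h

open Classical in
/-- The Young symmetrizer `c_μ = a_μ b_μ` in the group algebra of the symmetric group, where `a_μ`
is the sum of the row-preserving permutations and `b_μ` is the sum of the column-preserving
permutations weighted by their signs. -/
def YoungDiagram.youngSymmetrizer (R : Type*) [CommRing R] (μ : YoungDiagram) :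
    MonoidAlgebra R (Equiv.Perm μ.cells) :=
  (∑ σ : μ.rowStabilizer, MonoidAlgebra.single (σ : Equiv.Perm μ.cells) (1 : R)) *
    ∑ τ : μ.colStabilizer,
      MonoidAlgebra.single (τ : Equiv.Perm μ.cells) (((Equiv.Perm.sign τ.1 : ℤˣ) : ℤ) : R)

/-- The image `M_μ` of the Lie module `M` under the Schur functor of `μ`: the submodule
`c_μ (M^{⊗ |μ|})` of the tensor power `M^{⊗ |μ|}`. -/
def schurModule (R L M : Type*) [CommRing R] [LieRing L] [LieAlgebra R L]
    [AddCommGroup M] [Module R M] [LieRingModule L M] [LieModule R L M] (μ : YoungDiagram) :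
    LieSubmodule R L (⨂[R] _ : μ.cells, M) :=
  (groupAlgebraTensorHom R L M (μ.youngSymmetrizer R)).range

end Schur

end

/-! Write `Q` for `V^*/V_*`. Two facts combine. First, the Mackey Lie algebra acts on `Q` through a
unital associative algebra, and this algebra is dense: finitely many independent vectors of `Q` can
be sent to arbitrary vectors. The required endomorphism is an infinite sum of rank one operators
that is locally finite both on `V` and on `V_*`; countable bases on both sides make the construction
triangular (`exists_mem_mackeyLieAlgebra_comp_eq`).

Second, a dense algebra forces Schur functors to be simple (`schurModule_isIrreducible`). A subspace
of the tensor power stable under all derivations is stable under polarized operators `∑ σ, ⨂ φ (σ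
i)` (`symmetrizedMap_mem`). Applied to a nonzero tensor `t = c_μ s`, with the `φ i` picking out one
basis tensor in the support of `t`, such an operator yields `x · (⨂ q i)`, where the `q i` are
arbitrary and `x = c_μ y ≠ 0` lies in the group algebra (`symmetrizedMap_eq_permCoeff`). The right
ideal of `c_μ` is minimal, so `x z = c_μ` for some `z` (`exists_mul_eq_youngSymmetrizer`), and the
submodule contains the whole image of `c_μ`. -/

noncomputable section

/-! ### Combinatorics of row and column permutations -/

namespace YoungDiagram

variable {μ : YoungDiagram}

theorem card_row_filter_lt_le {κ : μ.cells → ℕ}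
    (hκ : ∀ c d : μ.cells, c.1.1 = d.1.1 → κ c = κ d → c = d) (i j : ℕ) :
    (Finset.univ.filter fun c : μ.cells => c.1.1 = i ∧ κ c < j).card ≤
      (Finset.univ.filter fun c : μ.cells => c.1.1 = i ∧ c.1.2 < j).card := by
  rcases le_or_gt j (μ.rowLen i) with hj | hj
  · calc
      _ ≤ (Finset.range j).card := by
        refine Finset.card_le_card_of_injOn κ (fun c hc => ?_) (fun c hc d hd h => ?_)
        · simp only [Finset.coe_filter, Set.mem_ofPred_eq] at hc
          simpa using hc.2.2
        · simp only [Finset.coe_filter, Set.mem_ofPred_eq] at hc hd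
          exact hκ c d (hc.2.1.trans hd.2.1.symm) h
      _ ≤ _ := by
        refine Finset.card_le_card_of_surjOn (fun c => c.1.2) fun n hn => ?_
        have hn' : n < j := by simpa using hn
        have hm : (i, n) ∈ μ.cells := mem_cells _ |>.2 (mem_iff_lt_rowLen.2 (hn'.trans_le hj))
        exact ⟨⟨(i, n), hm⟩, by simpa using hn', rfl⟩
  · refine Finset.card_le_card fun c hc => ?_
    simp only [Finset.mem_filter, Finset.mem_univ, true_and] at hc ⊢
    refine ⟨hc.1, lt_trans ?_ hj⟩
    have := (mem_cells _).1 c.2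
    rw [← hc.1]
    exact mem_iff_lt_rowLen.1 this

/-- A double count: since `h` is a bijection, as many cells satisfy `(h d).1.2 < j` as `d.1.2 < j`.
Row by row the first count is at most the second, so they agree in every row; for `j` the length of
the row of `c`, the second count is the whole row. -/
theorem snd_lt_rowLen_of_injective_on_rows (h : Equiv.Perm μ.cells)
    (hh : ∀ c d : μ.cells, c.1.1 = d.1.1 → (h c).1.2 = (h d).1.2 → c = d) (c : μ.cells) :
    (h c).1.2 < μ.rowLen c.1.1 := by
  classical
  set j := μ.rowLen c.1.1 with hj
  set I : Finset ℕ := Finset.univ.image fun d : μ.cells => d.1.1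
  have fiber (p : μ.cells → Prop) [DecidablePred p] : (Finset.univ.filter p).card =
      ∑ i ∈ I, (Finset.univ.filter fun d : μ.cells => d.1.1 = i ∧ p d).card := by
    rw [Finset.card_eq_sum_card_fiberwise (f := fun d : μ.cells => d.1.1) (t := I)
      (fun d _ => by simp [I])]
    refine Finset.sum_congr rfl fun i _ => ?_
    rw [Finset.filter_filter]
    simp only [and_comm]
  have total : (Finset.univ.filter fun d : μ.cells => (h d).1.2 < j).card =
      (Finset.univ.filter fun d : μ.cells => d.1.2 < j).card :=
    Finset.card_equiv h fun d => by simp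
  rw [fiber, fiber, Finset.sum_eq_sum_iff_of_le fun i _ => card_row_filter_lt_le hh i j] at total
  have key := total c.1.1 (by simp [I])
  have full : (Finset.univ.filter fun d : μ.cells => d.1.1 = c.1.1 ∧ d.1.2 < j) =
      Finset.univ.filter fun d : μ.cells => d.1.1 = c.1.1 := by
    refine Finset.filter_congr fun d _ => and_iff_left_of_imp fun hd => ?_
    rw [hj, ← hd]
    exact mem_iff_lt_rowLen.1 ((mem_cells _).1 d.2)
  rw [full] at key
  have eq := Finset.eq_of_subset_of_card_le (s := Finset.univ.filter fun d : μ.cells =>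
      d.1.1 = c.1.1 ∧ (h d).1.2 < j) (t := Finset.univ.filter fun d : μ.cells => d.1.1 = c.1.1)
    (fun d hd => by simp only [Finset.mem_filter] at hd ⊢; exact ⟨hd.1, hd.2.1⟩) key.ge
  have hc : c ∈ Finset.univ.filter fun d : μ.cells => d.1.1 = c.1.1 := by simp
  rw [← eq] at hc
  exact (Finset.mem_filter.1 hc).2.2

/-- A permutation of the cells whose inverse never sends two cells of a row into one column is the
product of a row-preserving and a column-preserving permutation. -/
theorem exists_eq_row_mul_col (g : Equiv.Perm μ.cells)
    (hg : ∀ c d : μ.cells, c.1.1 = d.1.1 → (g⁻¹ c).1.2 = (g⁻¹ d).1.2 → c = d) :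
    ∃ σ ∈ μ.rowStabilizer, ∃ τ ∈ μ.colStabilizer, g = σ * τ := by
  have mem (c : μ.cells) : (c.1.1, (g⁻¹ c).1.2) ∈ μ.cells :=
    (mem_cells _).2 (mem_iff_lt_rowLen.2 (snd_lt_rowLen_of_injective_on_rows g⁻¹ hg c))
  -- Keep the row of `c` but take the column of `g⁻¹ c`: the inverse of this permutation is the row
  -- factor.
  let p : μ.cells → μ.cells := fun c => ⟨_, mem c⟩
  have inj : Function.Injective p := fun c d h => by
    have h' := congrArg Subtype.val h
    simp only [p, Prod.mk.injEq] at h'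
    exact hg c d h'.1 h'.2
  let P : Equiv.Perm μ.cells := Equiv.ofBijective p (Finite.injective_iff_bijective.1 inj)
  have hP : P ∈ μ.rowStabilizer := fun c => rfl
  refine ⟨P⁻¹, inv_mem hP, P * g, fun c => ?_, by simp⟩
  change (g⁻¹ (g c)).1.2 = c.1.2
  simp

theorem eq_one_of_mem_rowStabilizer_of_mem_colStabilizer {σ : Equiv.Perm μ.cells}
    (hr : σ ∈ μ.rowStabilizer) (hc : σ ∈ μ.colStabilizer) : σ = 1 :=
  Equiv.ext fun c => Subtype.ext (Prod.ext (hr c) (hc c))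

/-! ### The Young symmetrizer and its minimal right ideal -/

section Symmetrizer

variable {K : Type*} [Field K]

open Classical in
theorem single_mul_youngSymmetrizer {σ : Equiv.Perm μ.cells} (hσ : σ ∈ μ.rowStabilizer) :
    MonoidAlgebra.single σ (1 : K) * μ.youngSymmetrizer K = μ.youngSymmetrizer K := by
  have h : MonoidAlgebra.single σ (1 : K) *
      ∑ ρ : μ.rowStabilizer, MonoidAlgebra.single (ρ : Equiv.Perm μ.cells) (1 : K) =
        ∑ ρ : μ.rowStabilizer, MonoidAlgebra.single (ρ : Equiv.Perm μ.cells) (1 : K) := by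
    rw [Finset.mul_sum]
    refine Fintype.sum_equiv (Equiv.mulLeft (⟨σ, hσ⟩ : μ.rowStabilizer)) _ _ fun ρ => ?_
    simp [MonoidAlgebra.single_mul_single]
  rw [youngSymmetrizer, ← mul_assoc, h]

open Classical in
theorem youngSymmetrizer_mul_single {τ : Equiv.Perm μ.cells} (hτ : τ ∈ μ.colStabilizer) :
    μ.youngSymmetrizer K * MonoidAlgebra.single τ (1 : K) =
      ((Equiv.Perm.sign τ : ℤˣ) : K) • μ.youngSymmetrizer K := by
  have h : (∑ ρ : μ.colStabilizer, MonoidAlgebra.single (ρ : Equiv.Perm μ.cells)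
      (((Equiv.Perm.sign ρ.1 : ℤˣ) : ℤ) : K)) * MonoidAlgebra.single τ (1 : K) =
        ((Equiv.Perm.sign τ : ℤˣ) : K) • ∑ ρ : μ.colStabilizer,
          MonoidAlgebra.single (ρ : Equiv.Perm μ.cells)
            (((Equiv.Perm.sign ρ.1 : ℤˣ) : ℤ) : K) := by
    rw [Finset.sum_mul, Finset.smul_sum]
    refine Fintype.sum_equiv (Equiv.mulRight (⟨τ, hτ⟩ : μ.colStabilizer)) _ _ fun ρ => ?_
    have hs : (((Equiv.Perm.sign τ : ℤˣ) : ℤ) : K) * (((Equiv.Perm.sign τ : ℤˣ) : ℤ) : K) = 1 := by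
      rw [← Int.cast_mul, ← Units.val_mul, Int.units_mul_self]; simp
    simp [MonoidAlgebra.single_mul_single, MonoidAlgebra.smul_single]
    linear_combination -((Equiv.Perm.sign ρ.1 : ℤˣ) : K) * hs
  rw [youngSymmetrizer, mul_assoc, h, mul_smul_comm]

theorem coeff_one_youngSymmetrizer : (μ.youngSymmetrizer K).coeff 1 = 1 := by
  classical
  rw [youngSymmetrizer, Finset.sum_mul_sum]
  simp only [MonoidAlgebra.single_mul_single, MonoidAlgebra.coeff_sum, Finsupp.finsetSum_apply,
    MonoidAlgebra.coeff_single, Finsupp.single_apply]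
  rw [Finset.sum_eq_single 1, Finset.sum_eq_single 1]
  · simp
  · intro τ _ hτ
    rw [if_neg]
    simpa using hτ
  · simp
  · intro σ _ hσ
    refine Finset.sum_eq_zero fun τ _ => if_neg fun h => hσ ?_
    have : (σ : Equiv.Perm μ.cells) = (τ : Equiv.Perm μ.cells)⁻¹ := eq_inv_of_mul_eq_one_left h
    exact Subtype.ext (eq_one_of_mem_rowStabilizer_of_mem_colStabilizer σ.2
      (this ▸ inv_mem τ.2))
  · simp

variable [CharZero K]

/-- **Von Neumann's lemma**: up to scalars, the Young symmetrizer is the only element of the group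
algebra that is invariant under the row stabilizer on the left and transforms by the sign under the
column stabilizer on the right. -/
theorem eq_smul_youngSymmetrizer {w : MonoidAlgebra K (Equiv.Perm μ.cells)}
    (hr : ∀ σ ∈ μ.rowStabilizer, MonoidAlgebra.single σ (1 : K) * w = w)
    (hc : ∀ τ ∈ μ.colStabilizer,
      w * MonoidAlgebra.single τ (1 : K) = ((Equiv.Perm.sign τ : ℤˣ) : K) • w) :
    w = w.coeff 1 • μ.youngSymmetrizer K := by
  classical
  set v := w - w.coeff 1 • μ.youngSymmetrizer K with hv
  have hvr : ∀ σ ∈ μ.rowStabilizer, ∀ g, v.coeff (σ * g) = v.coeff g := by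
    intro σ hσ g
    have h : MonoidAlgebra.single σ (1 : K) * v = v := by
      rw [hv, mul_sub, hr σ hσ, mul_smul_comm, single_mul_youngSymmetrizer hσ]
    conv_lhs => rw [← h]
    simp
  have hvc : ∀ τ ∈ μ.colStabilizer, ∀ g,
      v.coeff (g * τ) = ((Equiv.Perm.sign τ : ℤˣ) : K) * v.coeff g := by
    intro τ hτ g
    have h : v * MonoidAlgebra.single τ⁻¹ (1 : K) = ((Equiv.Perm.sign τ : ℤˣ) : K) • v := by
      rw [hv, sub_mul, hc _ (inv_mem hτ), smul_mul_assoc,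
        youngSymmetrizer_mul_single (inv_mem hτ), smul_sub, smul_comm, Equiv.Perm.sign_inv]
    have h' := congrArg (fun x => x.coeff g) h
    simpa using h'
  have hv1 : v.coeff 1 = 0 := by
    simp [hv, coeff_one_youngSymmetrizer]
  suffices h : v = 0 from sub_eq_zero.1 h
  ext g
  simp only [MonoidAlgebra.coeff_zero, Finsupp.coe_zero, Pi.zero_apply]
  by_cases hg : ∀ c d : μ.cells, c.1.1 = d.1.1 → (g⁻¹ c).1.2 = (g⁻¹ d).1.2 → c = d
  · obtain ⟨σ, hσ, τ, hτ, rfl⟩ := exists_eq_row_mul_col g hg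
    rw [hvr σ hσ, ← one_mul τ, hvc τ hτ, hv1, mul_zero]
  · push Not at hg
    obtain ⟨c, d, hrow, hcol, hne⟩ := hg
    -- A row transposition on the left of `g` equals a column transposition on its right, so the
    -- coefficient at `g` is its own negative.
    have hσ : Equiv.swap c d ∈ μ.rowStabilizer := fun e => by
      rw [Equiv.swap_apply_def]; split_ifs <;> simp_all
    have hτ : Equiv.swap (g⁻¹ c) (g⁻¹ d) ∈ μ.colStabilizer := fun e => by
      rw [Equiv.swap_apply_def]; split_ifs <;> simp_all
    have h1 : Equiv.swap c d * g = g * Equiv.swap (g⁻¹ c) (g⁻¹ d) := by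
      rw [Equiv.mul_swap_eq_swap_mul]; simp
    have h2 := hvr _ hσ g
    rw [h1, hvc _ hτ, Equiv.Perm.sign_swap (by simpa using hne)] at h2
    simpa [self_eq_neg, neg_eq_self] using h2

/-- The right ideal generated by the Young symmetrizer is minimal. -/
theorem exists_mul_eq_youngSymmetrizer {y : MonoidAlgebra K (Equiv.Perm μ.cells)}
    (hy : μ.youngSymmetrizer K * y ≠ 0) :
    ∃ z, μ.youngSymmetrizer K * y * z = μ.youngSymmetrizer K := by
  set c := μ.youngSymmetrizer K with hc
  set x := c * y with hx
  have hcard : NeZero ((Nat.card (Equiv.Perm μ.cells) : ℕ) : K) :=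
    ⟨Nat.cast_ne_zero.2 Nat.card_pos.ne'⟩
  -- By Maschke's theorem the left ideal of `x` is generated by an idempotent `a * x`, which fixes
  -- `x` on the right.
  obtain ⟨a, ha⟩ : ∃ a, x * a * x = x := by
    obtain ⟨e, he, hspan⟩ := IsSemisimpleRing.ideal_eq_span_idempotent
      (Ideal.span {x} : Ideal (MonoidAlgebra K (Equiv.Perm μ.cells)))
    have hex : e ∈ Ideal.span {x} := hspan ▸ Ideal.mem_span_singleton_self e
    have hxe : x ∈ Ideal.span {e} := hspan ▸ Ideal.mem_span_singleton_self x
    obtain ⟨a, rfl⟩ := Ideal.mem_span_singleton'.1 hex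
    obtain ⟨b, hb⟩ := Ideal.mem_span_singleton'.1 hxe
    refine ⟨a, ?_⟩
    rw [mul_assoc]
    nth_rw 1 [← hb]
    rw [mul_assoc, he.eq, hb]
  set w := x * a * c with hw
  have hwc : w = w.coeff 1 • c := by
    refine eq_smul_youngSymmetrizer (fun σ hσ => ?_) (fun τ hτ => ?_)
    · simp only [hw, hx, ← mul_assoc, hc, single_mul_youngSymmetrizer hσ]
    · rw [hw, mul_assoc, youngSymmetrizer_mul_single hτ, mul_smul_comm]
  -- Since `x = x * a * x = w * y`, a vanishing scalar would give `x = 0`.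
  have hw0 : w.coeff 1 ≠ 0 := fun h0 => by
    rw [h0, zero_smul] at hwc
    apply hy
    rw [← ha, hx, ← mul_assoc, ← hx, ← hw, hwc, zero_mul]
  refine ⟨(w.coeff 1)⁻¹ • (a * c), ?_⟩
  rw [mul_smul_comm, ← mul_assoc, ← hw, hwc, smul_smul]
  simp [hc, coeff_one_youngSymmetrizer, hw0]

end Symmetrizer

end YoungDiagram

/-! ### Polarization: from derivations to symmetrized operators -/

section SymmetrizedAction

variable {K M ι : Type*} [Field K] [AddCommGroup M] [Module K M] [Fintype ι] [DecidableEq ι]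

/-- The symmetrization `∑ σ, ⨂_{i} φ (σ i)` of a family of endomorphisms of `M`, as an endomorphism
of the tensor power. -/
def symmetrizedMap (φ : ι → Module.End K M) : Module.End K (⨂[K] _ : ι, M) :=
  ∑ σ : Equiv.Perm ι, PiTensorProduct.map fun i => φ (σ i)

theorem symmetrizedMap_tprod (φ : ι → Module.End K M) (m : ι → M) :
    symmetrizedMap φ (PiTensorProduct.tprod K m) =
      ∑ σ : Equiv.Perm ι, PiTensorProduct.tprod K fun i => φ (σ i) (m i) := by
  simp [symmetrizedMap, LinearMap.sum_apply, PiTensorProduct.map_tprod]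

theorem symmetrizedMap_comp_perm (φ : ι → Module.End K M) (ρ : Equiv.Perm ι) :
    symmetrizedMap (fun i => φ (ρ i)) = symmetrizedMap φ := by
  unfold symmetrizedMap
  refine Fintype.sum_equiv (Equiv.mulLeft ρ) _ _ fun σ => ?_
  simp

theorem sum_tensorFactorAction_mul_symmetrizedMap (ψ : Module.End K M)
    (φ : ι → Module.End K M) :
    (∑ i, tensorFactorAction K M i ψ) * symmetrizedMap φ =
      ∑ i, symmetrizedMap (Function.update φ i (ψ * φ i)) := by
  ext m
  simp only [LinearMap.compMultilinearMap_apply, Module.End.mul_apply, LinearMap.sum_apply,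
    symmetrizedMap_tprod, map_sum, tensorFactorAction_tprod]
  conv_rhs => rw [Finset.sum_comm]
  refine Finset.sum_congr rfl fun σ _ => ?_
  refine Fintype.sum_equiv σ _ _ fun i => ?_
  congr 1
  funext j
  by_cases hj : j = i
  · subst hj; simp
  · simp [hj]

/-- A subspace of the tensor power that is stable under the derivations coming from a unital algebra
`A` of endomorphisms is stable under the symmetrizations of families in `A`. -/
theorem symmetrizedMap_mem [CharZero K] {A : Subalgebra K (Module.End K M)}
    {N : Submodule K (⨂[K] _ : ι, M)}
    (hN : ∀ a ∈ A, ∀ t ∈ N, (∑ i, tensorFactorAction K M i a) t ∈ N)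
    {φ : ι → Module.End K M} (hφ : ∀ i, φ i ∈ A) {t : ⨂[K] _ : ι, M} (ht : t ∈ N) :
    symmetrizedMap φ t ∈ N := by
  suffices H : ∀ (s : Finset ι) (φ : ι → Module.End K M), (∀ i, φ i ∈ A) → (∀ i ∉ s, φ i = 1) →
      symmetrizedMap φ t ∈ N from H Finset.univ φ hφ (by simp)
  intro s
  induction s using Finset.induction_on with
  | empty =>
    intro φ _ h1
    obtain rfl : φ = fun _ => 1 := funext fun i => h1 i (by simp)
    have h : symmetrizedMap (fun _ : ι => (1 : Module.End K M)) =
        Fintype.card (Equiv.Perm ι) • (1 : Module.End K (⨂[K] _ : ι, M)) := by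
      simp only [symmetrizedMap, Finset.sum_const, Finset.card_univ]
      congr 1
      exact PiTensorProduct.map_id
    rw [h]
    change Fintype.card (Equiv.Perm ι) • t ∈ N
    exact nsmul_mem ht _
  | insert s₀ s hs ih =>
    intro φ hφ h1
    set φ' := Function.update φ s₀ 1 with hφ'
    have hφ'A : ∀ i, φ' i ∈ A := fun i => by
      by_cases hi : i = s₀
      · subst hi; simp [hφ']
      · simpa [hφ', hi] using hφ i
    have hφ's : ∀ i ∉ s, φ' i = 1 := fun i his => by
      by_cases hi : i = s₀
      · subst hi; simp [hφ']
      · simpa [hφ', hi] using h1 i (by simp [hi, his])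
    -- The derivation by `φ s₀` multiplies one entry of `φ'` at a time. At `i ∈ s` the family
    -- remains trivial off `s`, so induction applies. At `i ∉ s` an identity becomes `φ s₀`, which
    -- is `φ` up to a swap; these equal terms number `sᶜ.card`, nonzero because `s₀ ∉ s`.
    have hD := hN _ (hφ s₀) _ (ih φ' hφ'A hφ's)
    rw [← Module.End.mul_apply, sum_tensorFactorAction_mul_symmetrizedMap, LinearMap.sum_apply,
      ← Finset.sum_add_sum_compl s] at hD
    have hmem : ∑ i ∈ s, symmetrizedMap (Function.update φ' i (φ s₀ * φ' i)) t ∈ N := by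
      refine sum_mem fun i hi => ih _ (fun j => ?_) fun j hj => ?_
      · by_cases hji : j = i
        · subst hji; simpa using mul_mem (hφ s₀) (hφ'A j)
        · simpa [hji] using hφ'A j
      · have hji : j ≠ i := fun h => hj (h ▸ hi)
        simpa [hji] using hφ's j hj
    have heq : ∀ i ∈ sᶜ, symmetrizedMap (Function.update φ' i (φ s₀ * φ' i)) t =
        symmetrizedMap φ t := by
      intro i hi
      have his : i ∉ s := by simpa using hi
      rw [← symmetrizedMap_comp_perm φ (Equiv.swap i s₀), hφ's i his, mul_one]
      congr 2
      funext j
      rw [Equiv.swap_apply_def]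
      split_ifs with h h'
      · simp [h]
      · subst h'
        rw [Function.update_of_ne h, h1 i (by simp [his, Ne.symm h])]
        simp [hφ']
      · simp [hφ', h, h']
    rw [N.add_mem_iff_right hmem, Finset.sum_congr rfl heq, Finset.sum_const] at hD
    have hcard : ((sᶜ.card : ℕ) : K) ≠ 0 :=
      Nat.cast_ne_zero.2 (Finset.card_ne_zero_of_mem (Finset.mem_compl.2 hs))
    rwa [← Nat.cast_smul_eq_nsmul K, N.smul_mem_iff hcard] at hD

end SymmetrizedAction

/-! ### Coefficients of tensors in the group algebra -/

section Multilinearization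

variable {K M ι κ : Type*} [Field K] [AddCommGroup M] [Module K M] [Fintype ι] [DecidableEq ι]

omit [DecidableEq ι] in
theorem piTensorProduct_repr_permTensorRep (b : Module.Basis κ K M) (τ : Equiv.Perm ι)
    (t : ⨂[K] _ : ι, M) (f : ι → κ) :
    (Basis.piTensorProduct fun _ : ι => b).repr (permTensorRep K M ι τ t) f =
      (Basis.piTensorProduct fun _ : ι => b).repr t (f ∘ τ) := by
  induction t using PiTensorProduct.induction_on with
  | smul_tprod r m =>
    simp only [map_smul, permTensorRep_tprod, Finsupp.smul_apply,
      Basis.piTensorProduct_repr_tprod_apply]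
    congr 1
    exact Fintype.prod_equiv τ.symm _ _ fun i => by simp
  | add s t hs ht => simp [hs, ht]

/-- The coefficients of a tensor along the permutations of a given basis tensor, as an element of
the group algebra. -/
def permCoeff (b : Module.Basis κ K M) (f : ι → κ) :
    (⨂[K] _ : ι, M) →ₗ[K] MonoidAlgebra K (Equiv.Perm ι) where
  toFun t := ∑ σ : Equiv.Perm ι,
    (Basis.piTensorProduct fun _ : ι => b).repr t (f ∘ σ) • MonoidAlgebra.single σ⁻¹ (1 : K)
  map_add' s t := by simp only [map_add, Finsupp.add_apply, add_smul, Finset.sum_add_distrib]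
  map_smul' r t := by
    simp only [map_smul, Finsupp.smul_apply, smul_assoc, Finset.smul_sum, RingHom.id_apply]

theorem permCoeff_apply (b : Module.Basis κ K M) (f : ι → κ) (t : ⨂[K] _ : ι, M) :
    permCoeff b f t = ∑ σ : Equiv.Perm ι,
      (Basis.piTensorProduct fun _ : ι => b).repr t (f ∘ σ) • MonoidAlgebra.single σ⁻¹ (1 : K) :=
  rfl

theorem permCoeff_asAlgebraHom (b : Module.Basis κ K M) (f : ι → κ)
    (c : MonoidAlgebra K (Equiv.Perm ι)) (t : ⨂[K] _ : ι, M) :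
    permCoeff b f ((permTensorRep K M ι).asAlgebraHom c t) = c * permCoeff b f t := by
  induction c using MonoidAlgebra.induction_on with
  | of τ =>
    rw [Representation.asAlgebraHom_of]
    simp only [permCoeff_apply, piTensorProduct_repr_permTensorRep,
      MonoidAlgebra.of_apply, Finset.mul_sum, mul_smul_comm, MonoidAlgebra.single_mul_single]
    refine Fintype.sum_equiv (Equiv.mulRight τ) _ _ fun σ => ?_
    simp [Function.comp_assoc]
  | add a c ha hc => simp [ha, hc, add_mul]
  | smul r a ha => simp [ha]

theorem coeff_one_permCoeff (b : Module.Basis κ K M) (f : ι → κ) (t : ⨂[K] _ : ι, M) :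
    (permCoeff b f t).coeff 1 = (Basis.piTensorProduct fun _ : ι => b).repr t f := by
  rw [permCoeff_apply]
  simp only [MonoidAlgebra.coeff_sum, Finsupp.finsetSum_apply, MonoidAlgebra.coeff_smul,
    MonoidAlgebra.coeff_single, Finsupp.smul_apply, Finsupp.single_apply]
  rw [Finset.sum_eq_single 1]
  · simp
  · intro σ _ hσ
    simp [hσ]
  · simp

theorem permCoeff_tprod_basis_self (b : Module.Basis κ K M) {f : ι → κ}
    (hf : Function.Injective f) :
    permCoeff b f (PiTensorProduct.tprod K fun i => b (f i)) = 1 := by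
  classical
  rw [permCoeff_apply, ← Basis.piTensorProduct_apply (fun _ : ι => b) f, Module.Basis.repr_self,
    Finset.sum_eq_single 1]
  · simp [MonoidAlgebra.one_def]
  · intro σ _ hσ
    rw [Finsupp.single_eq_of_ne, zero_smul]
    intro h
    exact hσ (Equiv.ext fun i => hf (congrFun h i))
  · simp

/-- Applying to a tensor `t` the symmetrization of maps `φ i` that send `b (f i)` to `q i` and kill
the other basis vectors occurring in `t`. -/
theorem symmetrizedMap_eq_permCoeff (b : Module.Basis κ K M) (f : ι → κ) (q : ι → M)
    (t : ⨂[K] _ : ι, M) {φ : ι → Module.End K M}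
    (hφ : ∀ g ∈ ((Basis.piTensorProduct fun _ : ι => b).repr t).support, ∀ i j,
      φ i (b (g j)) = open Classical in if g j = f i then q i else 0) :
    symmetrizedMap φ t = (permTensorRep K M ι).asAlgebraHom (permCoeff b f t)
      (PiTensorProduct.tprod K q) := by
  classical
  set E := Basis.piTensorProduct fun _ : ι => b with hE
  have h (g) (hg : g ∈ (E.repr t).support) : symmetrizedMap φ (E g) =
      ∑ σ : Equiv.Perm ι, if f ∘ σ = g then PiTensorProduct.tprod K (fun i => q (σ i)) else 0 := by
    rw [hE, Basis.piTensorProduct_apply, symmetrizedMap_tprod]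
    refine Finset.sum_congr rfl fun σ _ => ?_
    split_ifs with hgσ
    · congr 1
      funext i
      rw [hφ g hg, if_pos (by rw [← hgσ]; rfl)]
    · obtain ⟨i, hi⟩ := Function.ne_iff.1 hgσ
      refine MultilinearMap.map_coord_zero _ i ?_
      rw [hφ g hg]
      exact if_neg (Ne.symm hi)
  conv_lhs => rw [← E.linearCombination_repr t, Finsupp.linearCombination_apply, Finsupp.sum]
  rw [map_sum]
  simp only [map_smul]
  rw [Finset.sum_congr rfl fun g hg => by rw [h g hg, Finset.smul_sum], Finset.sum_comm,
    permCoeff_apply, map_sum, LinearMap.sum_apply]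
  refine Finset.sum_congr rfl fun σ _ => ?_
  simp only [smul_ite, smul_zero, Finset.sum_ite_eq, map_smul, LinearMap.smul_apply,
    Representation.asAlgebraHom_single_one, permTensorRep_tprod]
  split_ifs with hs
  · rfl
  · rw [Finsupp.notMem_support_iff] at hs
    rw [← hE, hs, zero_smul]

end Multilinearization

/-! ### Simplicity of Schur functors under a dense action -/

section Irreducible

variable {K L M : Type*} [Field K] [CharZero K] [LieRing L] [LieAlgebra K L] [AddCommGroup M]
  [Module K M] [LieRingModule L M] [LieModule K L M]

/-- If the action of `L` on the infinite-dimensional module `M` is through a unital associative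
algebra of endomorphisms that acts densely, then all Schur functors of `M` are irreducible. -/
theorem schurModule_isIrreducible (A : Subalgebra K (Module.End K M))
    (hA : ∀ a ∈ A, ∃ x : L, LieModule.toEnd K L M x = a)
    (hdense : ∀ (n : ℕ) (e p : Fin n → M), LinearIndependent K e → ∃ a ∈ A, ∀ i, a (e i) = p i)
    (hM : ¬ Module.Finite K M) (μ : YoungDiagram) :
    LieModule.IsIrreducible K L (schurModule K L M μ) := by
  classical
  set b := Module.Basis.ofVectorSpace K M
  set E := Basis.piTensorProduct fun _ : μ.cells => b with hE
  set c := μ.youngSymmetrizer K with hc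
  have hinf : Infinite (Module.Basis.ofVectorSpaceIndex K M) := by
    by_contra h
    rw [not_infinite_iff_finite] at h
    exact hM (Module.Finite.of_basis b)
  have hrange (t : ⨂[K] _ : μ.cells, M) :
      t ∈ schurModule K L M μ ↔ ∃ s, (permTensorRep K M μ.cells).asAlgebraHom c s = t :=
    LieModuleHom.mem_range _ _
  have hnontriv : Nontrivial (schurModule K L M μ) := by
    let f : μ.cells ↪ Module.Basis.ofVectorSpaceIndex K M :=
      (Fintype.equivFin μ.cells).toEmbedding.trans
        (Fin.valEmbedding.trans (Infinite.natEmbedding _))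
    refine nontrivial_of_ne (⟨_, (hrange _).2 ⟨PiTensorProduct.tprod K fun i => b (f i), rfl⟩⟩ :
      schurModule K L M μ) 0 fun h => ?_
    have h1 := congrArg (permCoeff b f) (congrArg Subtype.val h)
    rw [permCoeff_asAlgebraHom, permCoeff_tprod_basis_self b f.injective, mul_one] at h1
    have h2 := congrArg (fun x => x.coeff 1) h1
    simp [hc, YoungDiagram.coeff_one_youngSymmetrizer] at h2
  refine LieModule.IsIrreducible.mk fun N hN => ?_
  obtain ⟨⟨t, htS⟩, htN, ht0⟩ : ∃ t ∈ N, t ≠ 0 := by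
    by_contra! h
    exact hN ((LieSubmodule.eq_bot_iff N).2 h)
  set N' : Submodule K (⨂[K] _ : μ.cells, M) :=
    (N : Submodule K (schurModule K L M μ)).map
      (schurModule K L M μ : Submodule K (⨂[K] _ : μ.cells, M)).subtype with hN'
  have hstab : ∀ a ∈ A, ∀ u ∈ N', (∑ i, tensorFactorAction K M i a) u ∈ N' := by
    rintro a ha _ ⟨u, hu, rfl⟩
    obtain ⟨x, rfl⟩ := hA a ha
    refine ⟨(⁅x, (u : schurModule K L M μ)⁆ : schurModule K L M μ), N.lie_mem hu, ?_⟩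
    change tensorPowerAction K L M μ.cells x u = _
    simp [tensorPowerAction]
  have ht : t ∈ N' := ⟨⟨t, htS⟩, htN, rfl⟩
  have ht0' : t ≠ 0 := fun h => ht0 (Subtype.ext h)
  obtain ⟨s, hs⟩ := (hrange t).1 htS
  obtain ⟨f, hf⟩ : ∃ f, E.repr t f ≠ 0 := by
    by_contra! h
    exact ht0' (E.repr.map_eq_zero_iff.1 (Finsupp.ext h))
  have hx : permCoeff b f t = c * permCoeff b f s := by
    rw [← hs, permCoeff_asAlgebraHom]
  -- The coefficient of `permCoeff b f t` at `1` is the coordinate of `t` at `f`, which is nonzero.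
  obtain ⟨z, hz⟩ := YoungDiagram.exists_mul_eq_youngSymmetrizer (K := K) (μ := μ)
    (y := permCoeff b f s) (by
      rw [← hc, ← hx]
      intro h
      apply hf
      rw [hE, ← coeff_one_permCoeff, h]
      rfl)
  rw [← hc, ← hx] at hz
  have hmem (u : ⨂[K] _ : μ.cells, M) :
      (permTensorRep K M μ.cells).asAlgebraHom (permCoeff b f t) u ∈ N' := by
    induction u using PiTensorProduct.induction_on with
    | add u v hu hv => rw [map_add]; exact add_mem hu hv
    | smul_tprod r q =>
      rw [map_smul]
      refine N'.smul_mem r ?_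
      -- The finitely many basis vectors that occur in `t`; density prescribes each `φ i` on all of
      -- them at once.
      set J : Finset (Module.Basis.ofVectorSpaceIndex K M) :=
        (E.repr t).support.biUnion fun g => Finset.univ.image g
      have hli : LinearIndependent K fun m : Fin J.card => b (J.equivFin.symm m) :=
        b.linearIndependent.comp _ (Subtype.val_injective.comp J.equivFin.symm.injective)
      choose φ hφA hφ using fun i => hdense _ _
        (fun m => if (J.equivFin.symm m : Module.Basis.ofVectorSpaceIndex K M) = f i
          then q i else 0) hli
      rw [← symmetrizedMap_eq_permCoeff b f q t (φ := φ)]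
      · exact symmetrizedMap_mem hstab hφA ht
      · intro g hg i j
        have hJ : g j ∈ J := Finset.mem_biUnion.2 ⟨g, hg, Finset.mem_image_of_mem g (by simp)⟩
        have := hφ i (J.equivFin ⟨g j, hJ⟩)
        simp only [Equiv.symm_apply_apply] at this
        rw [this]
        congr
  rw [eq_top_iff]
  rintro ⟨u, hu⟩ -
  obtain ⟨v, rfl⟩ := (hrange u).1 hu
  have h := hmem ((permTensorRep K M μ.cells).asAlgebraHom z v)
  rw [← Module.End.mul_apply, ← map_mul, hz] at h
  obtain ⟨w, hw, hwv⟩ := h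
  have : w = ⟨_, hu⟩ := Subtype.ext hwv
  exact this ▸ hw

end Irreducible

/-! ### Finite and triangular linear systems -/

section LinearAlgebra

variable {K V : Type*} [Field K] [AddCommGroup V] [Module K V]

theorem LinearIndependent.exists_forall_dual_apply_eq {ι : Type*} [Finite ι]
    {f : ι → V →ₗ[K] K} (hf : LinearIndependent K f) (c : ι → K) : ∃ v, ∀ i, f i v = c i := by
  classical
  have := Fintype.ofFinite ι
  suffices h : Function.Surjective (LinearMap.pi f) by
    obtain ⟨v, hv⟩ := h c
    exact ⟨v, fun i => congrFun hv i⟩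
  rw [← LinearMap.dualMap_injective_iff, injective_iff_map_eq_zero]
  intro φ hφ
  have hsingle (i : ι) : (fun j => if i = j then (1 : K) else 0) = Pi.single i 1 := by
    ext j
    simp [Pi.single_apply, eq_comm]
  have key : ∑ i, φ (Pi.single i 1) • f i = 0 := by
    ext v
    have h := LinearMap.congr_fun hφ v
    rw [LinearMap.dualMap_apply, LinearMap.pi_apply_eq_sum_univ φ] at h
    simpa [LinearMap.sum_apply, mul_comm, hsingle] using h
  have h0 := Fintype.linearIndependent_iff.1 hf _ key
  refine LinearMap.pi_ext' fun i => LinearMap.ext_ring ?_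
  simpa using h0 i

/-- Forward substitution: the `j`-th equation determines `c j` from the earlier values, as its
coefficient is `1`. -/
theorem exists_forall_sum_range_succ_mul_eq {T : ℕ → ℕ → K} (hT : ∀ j, T j j = 1) (a : ℕ → K) :
    ∃ c : ℕ → K, ∀ j, ∑ m ∈ Finset.range (j + 1), c m * T m j = a j := by
  refine ⟨WellFounded.fix (C := fun _ => K) Nat.lt_wfRel.wf
    fun j ih => a j - ∑ m : Fin j, ih m m.2 * T m j, fun j => ?_⟩
  rw [Finset.sum_range_succ, WellFounded.fix_eq _ _ j, hT, mul_one, Finset.sum_range]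
  exact add_sub_cancel _ _

theorem exists_basis_nat_of_rank_eq_aleph0 (h : Module.rank K V = Cardinal.aleph0) :
    Nonempty (Module.Basis ℕ K V) := by
  let b := Module.Basis.ofVectorSpace K V
  rw [← b.mk_eq_rank'', ← Cardinal.denumerable_iff] at h
  obtain ⟨h⟩ := h
  exact ⟨b.reindex (Denumerable.eqv _)⟩

end LinearAlgebra

/-! ### Density of the Mackey Lie algebra on the quotient -/

section Mackey

variable {V W : Type*} [AddCommGroup V] [Module ℂ V] [AddCommGroup W] [Module ℂ W]

/-- Functionals that are linearly independent modulo the image of `W` can be moved to arbitrary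
functionals by a single element of the Mackey Lie algebra. -/
theorem exists_mem_mackeyLieAlgebra_comp_eq
    (hV : Module.rank ℂ V = Cardinal.aleph0) (hW : Module.rank ℂ W = Cardinal.aleph0)
    {B : W →ₗ[ℂ] V →ₗ[ℂ] ℂ} (hB : B.Nondegenerate) {ι : Type*} [Finite ι] {f : ι → V →ₗ[ℂ] ℂ}
    (hf : LinearIndependent ℂ fun i => (LinearMap.range B).mkQ (f i)) (g : ι → V →ₗ[ℂ] ℂ) :
    ∃ φ ∈ mackeyLieAlgebra B, ∀ i, f i ∘ₗ φ = g i := by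
  obtain ⟨x⟩ := exists_basis_nat_of_rank_eq_aleph0 hV
  obtain ⟨w⟩ := exists_basis_nat_of_rank_eq_aleph0 hW
  have hinj : LinearMap.ker B = ⊥ := LinearMap.separatingLeft_iff_ker_eq_bot.1 hB.1
  have hinj' : LinearMap.ker B.flip = ⊥ := LinearMap.separatingRight_iff_flip_ker_eq_bot.1 hB.2
  have triangular (m : ℕ) : ∃ w', (∀ i < m, B w' (x i) = 0) ∧ B w' (x m) = 1 := by
    have hli : LinearIndependent ℂ fun i : Fin (m + 1) => B.flip (x i) :=
      (x.linearIndependent.comp _ Fin.val_injective).map' B.flip hinj'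
    obtain ⟨w', hw'⟩ := hli.exists_forall_dual_apply_eq fun i => if (i : ℕ) = m then 1 else 0
    refine ⟨w', fun i hi => ?_, ?_⟩
    · simpa [hi.ne] using hw' ⟨i, by omega⟩
    · simpa using hw' ⟨m, by omega⟩
  choose w' hw'0 hw'1 using triangular
  -- Formally `g i = ∑ m, c i m • B (w' m)`, a sum that is finite on each `x j`.
  choose c hc using fun i => exists_forall_sum_range_succ_mul_eq
    (T := fun m j => B (w' m) (x j)) hw'1 fun j => g i (x j)
  -- Independence modulo the image of `W` makes the `f i` independent together with any finite part
  -- of the basis of `W`, so both conditions can be imposed.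
  have image (m : ℕ) : ∃ u, (∀ i, f i u = c i m) ∧ ∀ j < m, B (w j) u = 0 := by
    have hli₀ : LinearIndependent ℂ fun j : Fin m => B.rangeRestrict (w j) :=
      (w.linearIndependent.comp _ Fin.val_injective).map' B.rangeRestrict (by simpa using hinj)
    obtain ⟨u, hu⟩ := (hli₀.sumElim_of_quotient f hf).exists_forall_dual_apply_eq
      (Sum.elim 0 fun i => c i m)
    exact ⟨u, fun i => hu (Sum.inr i), fun j hj => hu (Sum.inl ⟨j, hj⟩)⟩
  choose u hu hu0 using image
  -- Formally `φ = ∑ m, B (w' m) ⊗ u m`; the terms with `m > j` vanish on `x j`.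
  set φ : V →ₗ[ℂ] V :=
    x.constr ℂ fun j => ∑ m ∈ Finset.range (j + 1), B (w' m) (x j) • u m with hφ
  have hφx (j : ℕ) : φ (x j) = ∑ m ∈ Finset.range (j + 1), B (w' m) (x j) • u m := by
    rw [hφ, Module.Basis.constr_basis]
  refine ⟨φ, ?_, fun i => x.ext fun j => ?_⟩
  · suffices h : (LinearMap.range B).comap (LinearMap.lcomp ℂ ℂ φ ∘ₗ B) = ⊤ by
      rintro _ ⟨v, rfl⟩
      exact (h ▸ Submodule.mem_top : v ∈ (LinearMap.range B).comap (LinearMap.lcomp ℂ ℂ φ ∘ₗ B))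
    rw [eq_top_iff, ← w.span_eq, Submodule.span_le]
    rintro _ ⟨j, rfl⟩
    -- Pulling `w j` back along `φ` gives a finite combination of the `w' m`, since `w j` kills `u
    -- m` for `m > j`.
    refine ⟨∑ m ∈ Finset.range (j + 1), B (w j) (u m) • w' m, x.ext fun l => ?_⟩
    simp only [map_sum, map_smul, LinearMap.sum_apply, LinearMap.smul_apply, smul_eq_mul,
      LinearMap.comp_apply, LinearMap.lcomp_apply, hφx]
    rw [Finset.sum_subset (Finset.range_subset_range.2 (show j + 1 ≤ max j l + 1 by omega)),
      Finset.sum_subset (s₁ := Finset.range (l + 1))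
        (Finset.range_subset_range.2 (show l + 1 ≤ max j l + 1 by omega))]
    · exact Finset.sum_congr rfl fun m _ => mul_comm _ _
    · intro m _ hm
      rw [hw'0 m l (by simpa using hm), zero_mul]
    · intro m _ hm
      rw [hu0 m j (by simpa using hm), zero_mul]
  · simp only [LinearMap.comp_apply, hφx, map_sum, map_smul, smul_eq_mul, hu]
    rw [← hc i j]
    exact Finset.sum_congr rfl fun m _ => mul_comm _ _

/-- The full dual of `V` has uncountable dimension, while the image of `W` has countable dimension.
-/
theorem not_finite_dualQuotient
    (hV : Module.rank ℂ V = Cardinal.aleph0) (hW : Module.rank ℂ W = Cardinal.aleph0)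
    (B : W →ₗ[ℂ] V →ₗ[ℂ] ℂ) : ¬ Module.Finite ℂ (DualQuotient B) := by
  intro h
  have h' : Module.Finite ℂ ((V →ₗ[ℂ] ℂ) ⧸ LinearMap.range B) := h
  have h1 := Submodule.rank_quotient_add_rank (LinearMap.range B)
  have h2 : Module.rank ℂ (LinearMap.range B) ≤ Cardinal.aleph0 := by
    have := lift_rank_range_le B
    rw [hW, Cardinal.lift_aleph0] at this
    exact Cardinal.lift_le_aleph0.1 this
  have h3 := lift_rank_lt_rank_dual (K := ℂ) (V := V) hV.ge
  rw [← h1, hV, Cardinal.lift_aleph0] at h3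
  exact h3.not_ge (Cardinal.add_le_aleph0.2 ⟨(Module.rank_lt_aleph0 _ _).le, h2⟩)

theorem toEnd_dualQuotient_mk (B : W →ₗ[ℂ] V →ₗ[ℂ] ℂ) (x : mackeyLieAlgebra B)
    (f : V →ₗ[ℂ] ℂ) :
    LieModule.toEnd ℂ (mackeyLieAlgebra B) (DualQuotient B) x (LieSubmodule.Quotient.mk f) =
      LieSubmodule.Quotient.mk (-(f ∘ₗ (x : Module.End ℂ V))) :=
  rfl

/-- The associative algebra of endomorphisms of `V^* / W` given by the Mackey Lie algebra. -/
def mackeyActionSubalgebra (B : W →ₗ[ℂ] V →ₗ[ℂ] ℂ) :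
    Subalgebra ℂ (Module.End ℂ (DualQuotient B)) :=
  (LinearMap.range (LieModule.toEnd ℂ (mackeyLieAlgebra B) (DualQuotient B) :
    mackeyLieAlgebra B →ₗ[ℂ] Module.End ℂ (DualQuotient B))).toSubalgebra
    (by
      refine ⟨⟨-LinearMap.id, fun f hf => ?_⟩, LinearMap.ext fun q => ?_⟩
      · rw [LinearMap.comp_neg, LinearMap.comp_id]
        exact neg_mem hf
      · obtain ⟨f, rfl⟩ := LieSubmodule.Quotient.surjective_mk' _ q
        refine (toEnd_dualQuotient_mk B _ f).trans ?_
        congr 1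
        ext v
        simp)
    (by
      rintro _ _ ⟨x, rfl⟩ ⟨y, rfl⟩
      -- Dualizing reverses products, and the two signs of the contragredient action cancel, hence
      -- `-(y ∘ x)`.
      refine ⟨⟨-((y : Module.End ℂ V) ∘ₗ (x : Module.End ℂ V)), fun f hf => ?_⟩,
        LinearMap.ext fun q => ?_⟩
      · rw [LinearMap.comp_neg, ← LinearMap.comp_assoc]
        exact neg_mem (x.2 _ (y.2 f hf))
      · obtain ⟨f, rfl⟩ := LieSubmodule.Quotient.surjective_mk' _ q
        refine (toEnd_dualQuotient_mk B _ f).trans ?_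
        refine Eq.trans ?_ (toEnd_dualQuotient_mk B x _).symm
        change LieSubmodule.Quotient.mk (-(f ∘ₗ (-((y : Module.End ℂ V) ∘ₗ x.1)))) =
          LieSubmodule.Quotient.mk (-((-(f ∘ₗ (y : Module.End ℂ V))) ∘ₗ x.1))
        congr 1
        ext v
        simp)

end Mackey

end

theorem proposition2p4 {V W : Type*} [AddCommGroup V] [Module ℂ V] [AddCommGroup W] [Module ℂ W]
    (hV : Module.rank ℂ V = Cardinal.aleph0) (hW : Module.rank ℂ W = Cardinal.aleph0)
    (B : W →ₗ[ℂ] V →ₗ[ℂ] ℂ) (hB : B.Nondegenerate)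
    (l : List ℕ) (hl : l.SortedGE) :
    LieModule.IsIrreducible ℂ (mackeyLieAlgebra B)
      (schurModule ℂ (mackeyLieAlgebra B) (DualQuotient B) (YoungDiagram.ofRowLens l hl)) := by
  refine schurModule_isIrreducible (mackeyActionSubalgebra B) (fun a ha => ha)
    (fun n e p he => ?_) (not_finite_dualQuotient hV hW B) _
  choose f hf using fun i => LieSubmodule.Quotient.surjective_mk' (pairingRange B) (e i)
  choose g hg using fun i => LieSubmodule.Quotient.surjective_mk' (pairingRange B) (p i)
  obtain rfl : (fun i => LieSubmodule.Quotient.mk' (pairingRange B) (f i)) = e := funext hf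
  obtain ⟨φ, hφ, hφf⟩ := exists_mem_mackeyLieAlgebra_comp_eq hV hW hB he fun i => -g i
  refine ⟨_, ⟨⟨φ, hφ⟩, rfl⟩, fun i => ?_⟩
  rw [← hg i]
  refine (toEnd_dualQuotient_mk B _ (f i)).trans ?_
  change LieSubmodule.Quotient.mk (-(f i ∘ₗ φ)) = _
  rw [hφf i, neg_neg]
  rfl
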